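/- Let $\sigma>0$, $D_e\ge 0$ and $\lambda\ge 0$. For every $n\ge 1$ let $\mathbf u\in\{-1,+1\}^n$ be a given watermark and let the covertext be $\mathbf X\sim\mathcal N(0,\sigma^2 I_n)$. For $\mathbf x\in\mathbb R^n$ put $\alpha^2=\frac1n\sum_i x_i^2$ and $\rho=\frac1n\sum_i x_iu_i$, and let $\operatorname{sgn}(t)=1$ for $t\ge0$ and $\operatorname{sgn}(t)=-1$ for $t<0$. The sign embedder is $\mathbf y=\mathbf x+\operatorname{sgn}(\rho)\sqrt{D_e}\,\mathbf u$. The improved sign embedder is $\mathbf y=a\mathbf x+b\mathbf u$ with $$(a,b)=\begin{cases}\bigl(0,\ \rho+\sqrt{\rho^2-\alpha^2+D_e}\bigr), & D_e\ge\alpha^2,\\ \bigl(1,\ \operatorname{sgn}(\rho)\sqrt{D_e}\bigr), & \text{otherwise.}\end{cases}$$ The detector declares the watermark present if and only if $\hat I_{\mathbf u\mathbf y}(U;Y)>\lambda$, where $$\hat I_{\mathbf u\mathbf y}(U;Y)=-\tfrac12\ln\Bigl(1-\frac{(\frac1n\sum_i u_iy_i)^2}{\frac1n\sum_i y_i^2}\Bigr)\in[0,\infty].$$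 The false-negative probability of an embedder is $P_{fn}^{(n)}=\Pr\{\hat I_{\mathbf u\mathbf Y}(U;Y)\le\lambda\}$, where $\mathbf Y$ is the output of the embedder on $(\mathbf X,\mathbf u)$, and its false-negative exponent is $\lim_{n\to\infty}-\frac1n\ln P_{fn}^{(n)}\in[0,\infty]$ (with $-\ln 0=\infty$). (i) If $\lambda>\frac12\ln2$, the false-negative exponent of the improved sign embedder exists and equals $$E(\lambda,D_e)=\begin{cases}0, & D_e\le\sigma^2,\\ \frac12\Bigl[\frac{D_e}{\sigma^2}-\ln\bigl(\frac{D_e}{\sigma^2}\bigr)-1\Bigr], & \text{otherwise.}\end{cases}$$ (ii) If $0\le\lambda\le\frac12\ln2$, the false-negative exponents of the improved sign embedder and of the sign embedder exist and are both equal to $E^{se}_{fn}(\lambda,D_e)$, where $E^{se}_{fn}(0,D_e)=\infty$ and, for $\lambda>0$, with $r_0=\frac{D_e e^{-2\lambda}}{1-e^{-2\lambda}}$, $$E^{se}_{fn}(\lambda,D_e)=\begin{cases}0, & r_0\le\sigma^2,\\ \frac12\Bigl[\frac{r_0}{\sigma^2}-\ln\bigl(\frac{r_0}{\sigma^2}\bigr)-1\Bigr],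 & \text{otherwise.}\end{cases}$$ -/

import Mathlib

open Filter Topology MeasureTheory ProbabilityTheory

namespace Watermark

noncomputable section

/-- The signum function with the convention `sgn 0 = 1`. -/
def sgn (t : ℝ) : ℝ := if 0 ≤ t then 1 else -1

/-- Empirical energy `(1/n) ∑ xᵢ²` of a vector. -/
def energy {n : ℕ} (x : Fin n → ℝ) : ℝ := (1 / (n : ℝ)) * ∑ i, x i ^ 2

/-- Empirical correlation `(1/n) ∑ xᵢ uᵢ`. -/
def corr {n : ℕ} (x u : Fin n → ℝ) : ℝ := (1 / (n : ℝ)) * ∑ i, x i * u i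

/-- An embedding rule: for each `n`, a map `(x, u) ↦ y` from the covertext and the watermark to the
stegotext. -/
abbrev Embedder : Type := (n : ℕ) → (Fin n → ℝ) → (Fin n → ℝ) → (Fin n → ℝ)

/-- The sign embedder `y = x + sgn(ρ) √D u`, with `ρ = (1/n) ∑ xᵢ uᵢ`. -/
def signEmbedder (D : ℝ) : Embedder := fun _ x u =>
  x + (sgn (corr x u) * √D) • u

/-- The pair `(a, b)` used by the improved sign embedder. -/
def improvedCoeffs (D : ℝ) {n : ℕ} (x u : Fin n → ℝ) : ℝ × ℝ :=
  if energy x ≤ D then (0, corr x u + √(corr x u ^ 2 - energy x + D))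
  else (1, sgn (corr x u) * √D)

/-- The improved sign embedder `y = a x + b u`. -/
def improvedSignEmbedder (D : ℝ) : Embedder := fun _ x u =>
  (improvedCoeffs D x u).1 • x + (improvedCoeffs D x u).2 • u

/-- The empirical mutual information
`Î(U;Y) = -(1/2) ln (1 - ((1/n) ∑ uᵢ yᵢ)² / ((1/n) ∑ yᵢ²))` of a `±1` vector `u` and a real vector
`y`. It is extended-real valued, and equal to `+∞` when `y` is a nonzero multiple of `u`.
(For `y = 0` the quotient is read as `0`.) -/
def empiricalMutualInfo {n : ℕ} (u y : Fin n → ℝ) : EReal :=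
  -(((1 / 2 : ℝ) : EReal) * ENNReal.log (ENNReal.ofReal (1 - corr y u ^ 2 / energy y)))

/-- The law of a covertext of length `n`: the Gaussian law with mean `0` and covariance `σ² I`. -/
def covertextLaw (σ : ℝ) (n : ℕ) : Measure (Fin n → ℝ) :=
  Measure.pi fun _ => gaussianReal 0 ⟨σ ^ 2, sq_nonneg σ⟩

/-- The false-negative probability at block length `n` of the embedder `f` and the watermark `u`:
the probability that the detector, which declares the watermark present if and only if
`Î(U;Y) > lam`, does not declare it present although `Y = f(X, u)`. -/
def falseNegProb (f : Embedder) (σ lam : ℝ) {n : ℕ} (u : Fin n → ℝ) : ENNReal :=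
  covertextLaw σ n {x | empiricalMutualInfo u (f n x u) ≤ (lam : EReal)}

/-- `E` is the false-negative exponent of the embedder `f` along the watermarks `u`:
`-(1/n) ln P_fn → E` in the extended reals (with `-ln 0 = +∞`). -/
def HasFalseNegExponent (f : Embedder) (σ lam : ℝ) (u : (n : ℕ) → Fin n → ℝ) (E : EReal) : Prop :=
  Tendsto (fun n : ℕ => -ENNReal.log (falseNegProb f σ lam (u n)) / (n : EReal)) atTop (𝓝 E)

/-- The function of `r` that is `0` for `r ≤ σ²` and `(1/2) [r/σ² - ln (r/σ²) - 1]` otherwise. -/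
def energyExponent (σ r : ℝ) : ℝ :=
  if r ≤ σ ^ 2 then 0 else (1 / 2) * (r / σ ^ 2 - Real.log (r / σ ^ 2) - 1)

/-- The closed form of the exponent of the sign embedder, with value `+∞` at `lam = 0`. -/
def signExponent (σ lam D : ℝ) : EReal :=
  if lam = 0 then ⊤
  else (energyExponent σ (D * Real.exp (-2 * lam) / (1 - Real.exp (-2 * lam))) : ℝ)

end

end Watermark

/-! ### Product measures: densities and null sets. -/

namespace Watermark

/-! Put c = exp(-2 lam) and r₀ = D c / (1 - c). The sign embedder leaves the part of x orthogonal to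
u, of energy α² - ρ², unchanged and lengthens the part along u to |ρ| + √D. A miss therefore forces
c (|ρ| + √D)² ≤ (1 - c)(α² - ρ²), hence α² ≥ r₀ when lam > 0; conversely, every x with ρ near 0 and
α² near some t > r₀ is missed. The improved embedder outputs a multiple of u when α² ≤ D, so it
misses there only if that multiple is 0, which forces α² = D. Its threshold is thus max(D, r₀), up
to a null set, and r₀ ≥ D exactly when c ≥ 1/2, i.e. lam ≤ (1/2) ln 2. At lam = 0 misses lie in the
null sets ρ = 0 or α² = D. What remains is the exponent of {α² ≥ r}, given by
`tendsto_neg_log_covertextLaw`: changing the variance gives a density depending on α² alone, which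
yields a Chernoff upper bound, and a lower bound from a typical set where ρ is also small. -/

theorem pi_withDensity_prod {ι : Type*} [Fintype ι] {Ω : ι → Type*} {mΩ : ∀ i, MeasurableSpace (Ω i)}
    (μ : ∀ i, Measure (Ω i)) [∀ i, IsProbabilityMeasure (μ i)] (f : ∀ i, Ω i → ENNReal)
    (hf : ∀ i, Measurable (f i)) [∀ i, SigmaFinite ((μ i).withDensity (f i))] :
    Measure.pi (fun i => (μ i).withDensity (f i)) =
      (Measure.pi μ).withDensity (fun x => ∏ i, f i (x i)) := by
  refine Measure.pi_eq fun s hs => ?_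
  rw [withDensity_apply _ (MeasurableSet.univ_pi hs), ← lintegral_indicator (MeasurableSet.univ_pi hs)]
  have hm : ∀ i, Measurable ((s i).indicator (f i)) := fun i => (hf i).indicator (hs i)
  have key : (Set.univ.pi s).indicator (fun x => ∏ i, f i (x i)) =
      fun x => ∏ i, (s i).indicator (f i) (x i) := by
    classical
    funext x
    by_cases hx : x ∈ Set.univ.pi s
    · rw [Set.indicator_of_mem hx]
      exact Finset.prod_congr rfl fun i _ => by rw [Set.indicator_of_mem (hx i trivial)]
    · rw [Set.indicator_of_notMem hx]
      simp only [Set.mem_pi, Set.mem_univ, true_implies, not_forall] at hx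
      obtain ⟨i, hi⟩ := hx
      exact (Finset.prod_eq_zero (Finset.mem_univ i) (Set.indicator_of_notMem hi _)).symm
  rw [key, lintegral_prod_eq_prod_lintegral_of_indepFun Finset.univ
    (fun i (x : ∀ i, Ω i) => (s i).indicator (f i) (x i))
    (iIndepFun_pi fun i => (hm i).aemeasurable) fun i => (hm i).comp (measurable_pi_apply i)]
  refine Finset.prod_congr rfl fun i _ => ?_
  rw [withDensity_apply _ (hs i), ← lintegral_indicator (hs i),
    ← (measurePreserving_eval μ i).lintegral_comp (hm i)]

/-- Fubini in coordinate 0: an atomless measure gives each countable slice mass zero. -/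
theorem pi_eq_zero_of_countable_slices {n : ℕ} (μ : Measure ℝ) [IsProbabilityMeasure μ] [NullSingletonClass μ]
    {S : Set (Fin (n + 1) → ℝ)} (hS : MeasurableSet S)
    (h : ∀ y : Fin n → ℝ, {t : ℝ | Fin.cons t y ∈ S}.Countable) :
    Measure.pi (fun _ : Fin (n + 1) => μ) S = 0 := by
  have hmp := (measurePreserving_piFinSuccAbove (fun _ : Fin (n + 1) => μ) 0).symm
  rw [← hmp.measure_preimage hS.nullMeasurableSet]
  have hm := (MeasurableEquiv.piFinSuccAbove (fun _ : Fin (n + 1) => ℝ) 0).symm.measurable hS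
  rw [Measure.prod_apply_symm hm]
  rw [lintegral_eq_zero_iff (measurable_measure_prodMk_right hm)]
  refine Eventually.of_forall fun y => ?_
  refine ((h y).mono fun t ht => ?_).measure_zero μ
  simpa [MeasurableEquiv.piFinSuccAbove, Fin.insertNthEquiv] using ht

/-! ### Energy, correlation and their null level sets. -/

theorem natCast_mul_energy {n : ℕ} (x : Fin n → ℝ) : (n : ℝ) * energy x = ∑ i, x i ^ 2 := by
  rcases Nat.eq_zero_or_pos n with rfl | hn
  · simp
  · have : (n : ℝ) ≠ 0 := by positivity
    unfold energy
    field_simp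

theorem natCast_mul_corr {n : ℕ} (x u : Fin n → ℝ) : (n : ℝ) * corr x u = ∑ i, x i * u i := by
  rcases Nat.eq_zero_or_pos n with rfl | hn
  · simp
  · have : (n : ℝ) ≠ 0 := by positivity
    unfold corr
    field_simp

@[fun_prop]
theorem measurable_energy {n : ℕ} : Measurable (energy : (Fin n → ℝ) → ℝ) := by
  unfold energy
  fun_prop

@[fun_prop]
theorem measurable_corr {n : ℕ} (u : Fin n → ℝ) : Measurable (fun x : Fin n → ℝ => corr x u) := by
  unfold corr
  fun_prop

theorem covertextLaw_eq_pi (σ : ℝ) (n : ℕ) : covertextLaw σ n =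
    Measure.pi fun _ => gaussianReal 0 (NNReal.mk (σ ^ 2) (sq_nonneg σ)) := rfl

theorem sq_nnreal_ne_zero {σ : ℝ} (hσ : 0 < σ) : NNReal.mk (σ ^ 2) (sq_nonneg σ) ≠ 0 := by
  rw [← NNReal.coe_ne_zero]
  exact (pow_pos hσ 2).ne'

instance (σ : ℝ) (n : ℕ) : IsProbabilityMeasure (covertextLaw σ n) := by
  rw [covertextLaw_eq_pi]
  infer_instance

theorem covertextLaw_energy_eq {σ : ℝ} (hσ : 0 < σ) {n : ℕ} (hn : 0 < n) (D : ℝ) :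
    covertextLaw σ n {x | energy x = D} = 0 := by
  obtain ⟨n, rfl⟩ : ∃ m, n = m + 1 := ⟨n - 1, by omega⟩
  have : NullSingletonClass (gaussianReal 0 (NNReal.mk (σ ^ 2) (sq_nonneg σ))) :=
    nullSingletonClass_gaussianReal (sq_nnreal_ne_zero hσ)
  rw [covertextLaw_eq_pi]
  refine pi_eq_zero_of_countable_slices _ (measurableSet_eq_fun (by fun_prop) (by fun_prop))
    fun y => ?_
  set c : ℝ := (n + 1 : ℕ) * D - ∑ i, y i ^ 2
  refine (Set.Countable.mono ?_ (Set.countable_insert.2 (Set.countable_singleton (-√c)) :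
    ({√c, -√c} : Set ℝ).Countable))
  intro t ht
  have h1 := natCast_mul_energy (Fin.cons t y : Fin (n + 1) → ℝ)
  rw [Set.mem_ofPred_eq, Set.mem_ofPred_eq] at ht
  rw [ht, Fin.sum_univ_succ] at h1
  simp only [Fin.cons_zero, Fin.cons_succ] at h1
  have h2 : t ^ 2 = c := by simp only [c]; linarith
  rw [← h2, Real.sqrt_sq_eq_abs]
  rcases abs_choice t with h | h <;> simp [h]

theorem covertextLaw_corr_eq_zero {σ : ℝ} (hσ : 0 < σ) {n : ℕ} (hn : 0 < n) (u : Fin n → ℝ)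
    (hu : ∀ i, u i ≠ 0) : covertextLaw σ n {x | corr x u = 0} = 0 := by
  obtain ⟨n, rfl⟩ : ∃ m, n = m + 1 := ⟨n - 1, by omega⟩
  have : NullSingletonClass (gaussianReal 0 (NNReal.mk (σ ^ 2) (sq_nonneg σ))) :=
    nullSingletonClass_gaussianReal (sq_nnreal_ne_zero hσ)
  rw [covertextLaw_eq_pi]
  refine pi_eq_zero_of_countable_slices _ (measurableSet_eq_fun (by fun_prop) (by fun_prop))
    fun y => ?_
  refine (Set.countable_singleton (-(∑ i, y i * u i.succ) / u 0)).mono ?_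
  intro t ht
  have h1 := natCast_mul_corr (Fin.cons t y : Fin (n + 1) → ℝ) u
  rw [Set.mem_ofPred_eq, Set.mem_ofPred_eq] at ht
  rw [ht, Fin.sum_univ_succ] at h1
  simp only [Fin.cons_zero, Fin.cons_succ] at h1
  rw [Set.mem_singleton_iff, eq_div_iff (hu 0)]
  linarith

/-! ### Change of variance. -/

theorem gaussianReal_eq_withDensity {σ τ : ℝ} (hσ : 0 < σ) (hτ : 0 < τ) :
    gaussianReal 0 (NNReal.mk (σ ^ 2) (sq_nonneg σ)) = (gaussianReal 0 (NNReal.mk (τ ^ 2) (sq_nonneg τ))).withDensity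
      (fun x => ENNReal.ofReal
        (Real.exp (Real.log (τ / σ) - x ^ 2 / 2 * (1 / σ ^ 2 - 1 / τ ^ 2)))) := by
  rw [gaussianReal_of_var_ne_zero _ (sq_nnreal_ne_zero hσ), gaussianReal_of_var_ne_zero _ (sq_nnreal_ne_zero hτ),
    ← withDensity_mul _ (by fun_prop) (by fun_prop)]
  congr 1
  funext x
  rw [Pi.mul_apply, gaussianPDF_def, gaussianPDF_def, ← ENNReal.ofReal_mul (gaussianPDFReal_nonneg _ _ _)]
  refine congrArg ENNReal.ofReal ?_
  simp only [gaussianPDFReal, NNReal.coe_mk, sub_zero]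
  rw [sub_eq_add_neg, Real.exp_add, Real.exp_log (by positivity),
    Real.sqrt_mul (by positivity) (σ ^ 2), Real.sqrt_mul (by positivity) (τ ^ 2),
    Real.sqrt_sq hσ.le, Real.sqrt_sq hτ.le]
  have : Real.exp (-x ^ 2 / (2 * σ ^ 2)) = Real.exp (-x ^ 2 / (2 * τ ^ 2)) *
      Real.exp (-(x ^ 2 / 2 * (1 / σ ^ 2 - 1 / τ ^ 2))) := by
    rw [← Real.exp_add]
    congr 1
    field_simp
    ring
  rw [this]
  field_simp

/-- Change of variance for the covertext law. -/
theorem covertextLaw_eq_withDensity {σ τ : ℝ} (hσ : 0 < σ) (hτ : 0 < τ) (n : ℕ) :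
    covertextLaw σ n = (covertextLaw τ n).withDensity (fun x => ENNReal.ofReal
      (Real.exp (n * (Real.log (τ / σ) - energy x / 2 * (1 / σ ^ 2 - 1 / τ ^ 2))))) := by
  have h := gaussianReal_eq_withDensity hσ hτ
  rw [covertextLaw_eq_pi, covertextLaw_eq_pi]
  conv_lhs => rw [h]
  have : SigmaFinite ((gaussianReal 0 (NNReal.mk (τ ^ 2) (sq_nonneg τ))).withDensity
      (fun x => ENNReal.ofReal
        (Real.exp (Real.log (τ / σ) - x ^ 2 / 2 * (1 / σ ^ 2 - 1 / τ ^ 2))))) := by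
    rw [← h]; infer_instance
  rw [pi_withDensity_prod _ _ (fun _ => by fun_prop)]
  congr 1
  funext x
  rw [← ENNReal.ofReal_prod_of_nonneg (fun _ _ => (Real.exp_pos _).le), ← Real.exp_sum]
  congr 2
  rw [Finset.sum_sub_distrib, ← Finset.sum_mul, ← Finset.sum_div, ← natCast_mul_energy]
  simp
  ring

theorem covertextLaw_apply_le {σ τ : ℝ} (hσ : 0 < σ) (hτ : 0 < τ) {n : ℕ} {c : ℝ}
    {S : Set (Fin n → ℝ)} (hS : MeasurableSet S)
    (h : ∀ x ∈ S, Real.log (τ / σ) - energy x / 2 * (1 / σ ^ 2 - 1 / τ ^ 2) ≤ c) :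
    covertextLaw σ n S ≤ ENNReal.ofReal (Real.exp (n * c)) * covertextLaw τ n S := by
  rw [covertextLaw_eq_withDensity hσ hτ, withDensity_apply _ hS, ← setLIntegral_const]
  refine setLIntegral_mono' hS fun x hx => ENNReal.ofReal_le_ofReal (Real.exp_le_exp.2 ?_)
  exact mul_le_mul_of_nonneg_left (h x hx) (Nat.cast_nonneg n)

theorem le_covertextLaw_apply {σ τ : ℝ} (hσ : 0 < σ) (hτ : 0 < τ) {n : ℕ} {c : ℝ}
    {S : Set (Fin n → ℝ)} (hS : MeasurableSet S)
    (h : ∀ x ∈ S, c ≤ Real.log (τ / σ) - energy x / 2 * (1 / σ ^ 2 - 1 / τ ^ 2)) :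
    ENNReal.ofReal (Real.exp (n * c)) * covertextLaw τ n S ≤ covertextLaw σ n S := by
  rw [covertextLaw_eq_withDensity hσ hτ, withDensity_apply _ hS, ← setLIntegral_const]
  refine setLIntegral_mono' hS fun x hx => ENNReal.ofReal_le_ofReal (Real.exp_le_exp.2 ?_)
  exact mul_le_mul_of_nonneg_left (h x hx) (Nat.cast_nonneg n)

/-! ### Typical vectors under the tilted law. -/

/-- Chebyshev's inequality for averages over a product of copies of a probability measure. -/
theorem pi_average_deviation_le {n : ℕ} (μ : Measure ℝ) [IsProbabilityMeasure μ]
    (X : Fin n → ℝ → ℝ) (hX : ∀ i, MemLp (X i) 2 μ) {m V δ : ℝ} (hm : ∀ i, ∫ t, X i t ∂μ = m)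
    (hV : ∀ i, Var[X i; μ] = V) (hδ : 0 < δ) (hn : 0 < n) :
    Measure.pi (fun _ : Fin n => μ) {x | δ ≤ |1 / (n : ℝ) * ∑ i, X i (x i) - m|} ≤
      ENNReal.ofReal (V / δ ^ 2 / n) := by
  have hn' : (0 : ℝ) < n := by exact_mod_cast hn
  have hmem : ∀ i, MemLp (fun x : Fin n → ℝ => X i (x i)) 2 (Measure.pi fun _ : Fin n => μ) :=
    fun i => (hX i).comp_measurePreserving (measurePreserving_eval (fun _ : Fin n => μ) i)
  have hsum : MemLp (∑ i, fun x : Fin n → ℝ => X i (x i)) 2 (Measure.pi fun _ : Fin n => μ) :=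
    memLp_finsetSum' _ fun i _ => hmem i
  have hexp : ∫ x, (∑ i, fun x : Fin n → ℝ => X i (x i)) x ∂(Measure.pi fun _ : Fin n => μ)
      = n * m := by
    simp only [Finset.sum_apply]
    rw [integral_finsetSum _ fun i _ => (hmem i).integrable (by norm_num)]
    simp [integral_comp_eval (μ := fun _ : Fin n => μ) (hX _).aestronglyMeasurable, hm]
  have hvar := variance_sum_pi (μ := fun _ : Fin n => μ) hX
  have hc := meas_ge_le_variance_div_sq hsum (mul_pos hn' hδ)
  rw [hexp, hvar] at hc
  simp only [hV, Finset.sum_const, Finset.card_univ, Fintype.card_fin, nsmul_eq_mul] at hc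
  have e : (n : ℝ) * V / (n * δ) ^ 2 = V / δ ^ 2 / n := by field_simp
  rw [e] at hc
  refine le_trans (measure_mono fun x hx => ?_) hc
  simp only [Set.mem_ofPred_eq, Finset.sum_apply] at hx ⊢
  have : ∑ i, X i (x i) - n * m = n * (1 / (n : ℝ) * ∑ i, X i (x i) - m) := by field_simp
  rw [this, abs_mul, abs_of_pos hn']
  exact mul_le_mul_of_nonneg_left hx hn'.le

theorem measurableSet_typical {n : ℕ} (u : Fin n → ℝ) (t δ : ℝ) :
    MeasurableSet {x : Fin n → ℝ | |energy x - t| < δ ∧ |corr x u| < δ} := by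
  have h1 : Measurable fun x : Fin n → ℝ => |energy x - t| := by fun_prop
  have h2 : Measurable fun x : Fin n → ℝ => |corr x u| := by fun_prop
  exact (h1 measurableSet_Iio).inter (h2 measurableSet_Iio)

theorem eventually_half_le_covertextLaw {τ : ℝ} (u : (n : ℕ) → Fin n → ℝ)
    (hu : ∀ n i, u n i = 1 ∨ u n i = -1) {δ : ℝ} (hδ : 0 < δ) :
    ∀ᶠ n : ℕ in atTop, (1 / 2 : ENNReal) ≤
      covertextLaw τ n {x | |energy x - τ ^ 2| < δ ∧ |corr x (u n)| < δ} := by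
  set μ := gaussianReal 0 (NNReal.mk (τ ^ 2) (sq_nonneg τ)) with hμ
  have hid : MemLp (id : ℝ → ℝ) 2 μ := memLp_id_gaussianReal 2
  have hsq : MemLp (fun t : ℝ => t ^ 2) 2 μ := by
    have h4 : MemLp (id : ℝ → ℝ) 4 μ := memLp_id_gaussianReal 4
    have : ENNReal.HolderTriple 4 4 2 := ⟨by
      rw [← ENNReal.toReal_eq_toReal_iff' (by simp) (by simp), ENNReal.toReal_add (by simp) (by simp)]
      norm_num⟩
    simpa [sq] using h4.mul' h4
  have hmean : ∫ t, t ∂μ = 0 := integral_id_gaussianReal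
  have hvarid : Var[id; μ] = τ ^ 2 := variance_id_gaussianReal
  have hmsq : ∫ t, t ^ 2 ∂μ = τ ^ 2 := by
    rw [← hvarid, variance_eq_sub hid]
    simp [hmean]
  set V := Var[fun t : ℝ => t ^ 2; μ] with hVdef
  have hbound : ∀ᶠ n : ℕ in atTop, ENNReal.ofReal (V / δ ^ 2 / n) ≤ 1 / 4 ∧
      ENNReal.ofReal (τ ^ 2 / δ ^ 2 / n) ≤ 1 / 4 := by
    have h : ∀ C : ℝ, ∀ᶠ n : ℕ in atTop, ENNReal.ofReal (C / n) ≤ 1 / 4 := fun C => by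
      have h1 : Tendsto (fun n : ℕ => ENNReal.ofReal (C / n)) atTop (𝓝 0) := by
        simpa using ENNReal.tendsto_ofReal (tendsto_const_div_atTop_nhds_zero_nat C)
      exact (h1.eventually (gt_mem_nhds (by norm_num : (0 : ENNReal) < 1 / 4))).mono
        fun _ h => h.le
    exact (h _).and (h _)
  filter_upwards [hbound, eventually_gt_atTop 0] with n hb hn
  have h1 : covertextLaw τ n {x | δ ≤ |energy x - τ ^ 2|} ≤ 1 / 4 :=
    (pi_average_deviation_le μ (fun _ t => t ^ 2) (fun _ => hsq) (fun _ => hmsq) (fun _ => rfl)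
      hδ hn).trans hb.1
  have h2 : covertextLaw τ n {x | δ ≤ |corr x (u n)|} ≤ 1 / 4 := by
    have := (pi_average_deviation_le μ (fun i t => t * u n i) (m := 0) (V := τ ^ 2)
      (fun i => hid.mul_const _) (fun i => by rw [integral_mul_const, hmean, zero_mul])
      (fun i => ?_) hδ hn).trans hb.2
    · simp only [sub_zero] at this
      exact this
    · rw [variance_mul_const]
      change Var[id; μ] * _ = _
      rw [hvarid]
      rcases hu n i with h | h <;> simp [h]
  have hms := measurableSet_typical (u n) (τ ^ 2) δ
  have hcompl : covertextLaw τ n {x | |energy x - τ ^ 2| < δ ∧ |corr x (u n)| < δ}ᶜ ≤ 1 / 2 := by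
    have hs : {x : Fin n → ℝ | |energy x - τ ^ 2| < δ ∧ |corr x (u n)| < δ}ᶜ ⊆
        {x | δ ≤ |energy x - τ ^ 2|} ∪ {x | δ ≤ |corr x (u n)|} := by
      intro x hx
      by_contra hcon
      simp only [Set.mem_union, Set.mem_ofPred_eq, not_or, not_le] at hcon
      exact hx hcon
    calc _ ≤ _ := measure_mono hs
      _ ≤ _ := measure_union_le _ _
      _ ≤ 1 / 4 + 1 / 4 := add_le_add h1 h2
      _ = 1 / 2 := by
        rw [← ENNReal.toReal_eq_toReal_iff' (by simp) (by simp)]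
        simp [ENNReal.toReal_add]
        norm_num
  have htot := prob_add_prob_compl (μ := covertextLaw τ n) hms
  by_contra hlt
  have := ENNReal.add_lt_add_of_lt_of_le (by simp) (not_le.1 hlt) hcompl
  rw [htot] at this
  simp [ENNReal.inv_two_add_inv_two] at this

/-! ### Large deviations of the energy. -/

theorem tendsto_neg_log_div_of_exp_bounds {P : ℕ → ENNReal} {E : ℝ}
    (hle : ∀ᶠ n : ℕ in atTop, P n ≤ ENNReal.ofReal (Real.exp (n * -E)))
    (hge : ∀ a > E, ∀ᶠ n : ℕ in atTop, ENNReal.ofReal (Real.exp (n * -a)) ≤ P n) :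
    Tendsto (fun n : ℕ => -ENNReal.log (P n) / (n : EReal)) atTop (𝓝 (E : EReal)) := by
  have hlog : ∀ (n : ℕ) (a : ℝ),
      ENNReal.log (ENNReal.ofReal (Real.exp (n * -a))) = -((a : EReal) * (n : EReal)) := by
    intro n a
    rw [ENNReal.log_ofReal_of_pos (Real.exp_pos _), Real.log_exp, ← EReal.coe_coe_eq_natCast,
      ← EReal.coe_mul, ← EReal.coe_neg]
    congr 1
    ring
  rw [tendsto_order]
  constructor
  · intro b hb
    filter_upwards [hle, eventually_gt_atTop 0] with n h hn
    refine hb.trans_le ?_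
    rw [EReal.le_div_iff_mul_le (by exact_mod_cast hn) (EReal.natCast_ne_top n), EReal.le_neg,
      ← hlog]
    exact ENNReal.log_le_log h
  · intro b hb
    obtain ⟨a, ha, hab⟩ := EReal.lt_iff_exists_real_btwn.1 hb
    filter_upwards [hge a (by exact_mod_cast ha), eventually_gt_atTop 0] with n h hn
    refine lt_of_le_of_lt ?_ hab
    rw [EReal.div_le_iff_le_mul (by exact_mod_cast hn) (EReal.natCast_ne_top n), EReal.neg_le,
      mul_comm, ← hlog]
    exact ENNReal.log_le_log h

theorem log_sqrt_div {σ t : ℝ} (hσ : 0 < σ) (ht : 0 < t) :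
    Real.log (√t / σ) = 1 / 2 * Real.log (t / σ ^ 2) := by
  rw [Real.log_div (by positivity) hσ.ne', Real.log_div ht.ne' (by positivity), Real.log_sqrt ht.le,
    Real.log_pow]
  push_cast
  ring

/-- Chernoff bound: for r > σ², tilt to variance r; on the event the density decreases in the
energy, so its largest value is at energy r. -/
theorem covertextLaw_energy_ge_le {σ : ℝ} (hσ : 0 < σ) (r : ℝ) (n : ℕ) :
    covertextLaw σ n {x | r ≤ energy x} ≤
      ENNReal.ofReal (Real.exp (n * -energyExponent σ r)) := by
  unfold energyExponent
  split_ifs with h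
  · simpa using prob_le_one
  · have hr : 0 < r := (pow_pos hσ 2).trans (not_le.1 h)
    have hms : MeasurableSet {x : Fin n → ℝ | r ≤ energy x} :=
      measurable_energy measurableSet_Ici
    refine (covertextLaw_apply_le hσ (Real.sqrt_pos.2 hr) (c := _) hms fun x hx => ?_).trans
      (mul_le_of_le_one_right' prob_le_one)
    rw [log_sqrt_div hσ hr, Real.sq_sqrt hr.le]
    have h1 : 0 ≤ 1 / σ ^ 2 - 1 / r :=
      sub_nonneg.2 (one_div_le_one_div_of_le (by positivity) (not_le.1 h).le)
    have h2 : r / 2 * (1 / σ ^ 2 - 1 / r) ≤ energy x / 2 * (1 / σ ^ 2 - 1 / r) :=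
      mul_le_mul_of_nonneg_right (div_le_div_of_nonneg_right hx (by norm_num)) h1
    have h3 : r / 2 * (1 / σ ^ 2 - 1 / r) = 1 / 2 * (r / σ ^ 2 - 1) := by field_simp
    linarith

/-- The exponent is the rate function at max r σ², since the rate vanishes at σ²; continuity leaves
room strictly to the right. -/
theorem exists_energyRate_lt {σ : ℝ} (hσ : 0 < σ) {r a : ℝ} (ha : energyExponent σ r < a) :
    ∃ t, r < t ∧ σ ^ 2 < t ∧ 1 / 2 * (t / σ ^ 2 - Real.log (t / σ ^ 2) - 1) < a := by
  have hs : 0 < σ ^ 2 := pow_pos hσ 2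
  have hmax : energyExponent σ r = 1 / 2 * (max r (σ ^ 2) / σ ^ 2 -
      Real.log (max r (σ ^ 2) / σ ^ 2) - 1) := by
    unfold energyExponent
    split_ifs with h
    · rw [max_eq_right h, div_self hs.ne']; simp
    · rw [max_eq_left (not_le.1 h).le]
  rw [hmax] at ha
  have hpos : 0 < max r (σ ^ 2) := lt_max_of_lt_right hs
  have hc : ContinuousAt (fun t => 1 / 2 * (t / σ ^ 2 - Real.log (t / σ ^ 2) - 1))
      (max r (σ ^ 2)) := by
    have : max r (σ ^ 2) / σ ^ 2 ≠ 0 := by positivity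
    fun_prop (disch := assumption)
  have h1 := (hc.tendsto.mono_left nhdsWithin_le_nhds).eventually (gt_mem_nhds ha)
    |>.and (self_mem_nhdsWithin (s := Set.Ioi (max r (σ ^ 2))))
  obtain ⟨t, ht, htm⟩ := h1.exists
  exact ⟨t, (le_max_left _ _).trans_lt htm, (le_max_right _ _).trans_lt htm, ht⟩

theorem eventually_exp_le_covertextLaw {σ : ℝ} (hσ : 0 < σ) (u : (n : ℕ) → Fin n → ℝ)
    (hu : ∀ n i, u n i = 1 ∨ u n i = -1) {S : (n : ℕ) → Set (Fin n → ℝ)} {t δ a : ℝ}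
    (hσt : σ ^ 2 < t) (hδ : 0 < δ)
    (hS : ∀ n > 0, ∀ x, |energy x - t| < δ → |corr x (u n)| < δ → x ∈ S n)
    (ha : 1 / 2 * (t / σ ^ 2 - Real.log (t / σ ^ 2) - 1) < a) :
    ∀ᶠ n : ℕ in atTop, ENNReal.ofReal (Real.exp (n * -a)) ≤ covertextLaw σ n (S n) := by
  have hs : 0 < σ ^ 2 := pow_pos hσ 2
  have ht : 0 < t := hs.trans hσt
  set J := 1 / 2 * (t / σ ^ 2 - Real.log (t / σ ^ 2) - 1) with hJ
  -- An energy excess η costs at most η / (2σ²) = (a - J)/2 in the exponent; the other half of the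
  -- gap a - J absorbs the factor 1/2 from the typical set.
  set η := (a - J) * σ ^ 2 with hη
  have hηpos : 0 < η := mul_pos (sub_pos.2 ha) hs
  have hdecay : ∀ᶠ n : ℕ in atTop, Real.exp (-((a - J) / 2 * n)) < 1 / 2 := by
    have : Tendsto (fun n : ℕ => Real.exp (-((a - J) / 2 * n))) atTop (𝓝 0) :=
      Real.tendsto_exp_neg_atTop_nhds_zero.comp
        (tendsto_natCast_atTop_atTop.const_mul_atTop (half_pos (sub_pos.2 ha)))
    exact this.eventually (gt_mem_nhds (by norm_num))
  filter_upwards [eventually_half_le_covertextLaw (τ := √t) u hu (lt_min hδ hηpos), hdecay,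
    eventually_gt_atTop 0] with n hhalf hd hn
  rw [Real.sq_sqrt ht.le] at hhalf
  have hlow := le_covertextLaw_apply (c := -((a + J) / 2)) hσ (Real.sqrt_pos.2 ht)
    (measurableSet_typical (u n) t (min δ η)) fun x hx => by
    have hx1 : energy x < t + η := by
      have := (abs_lt.1 hx.1).2.trans_le (min_le_right δ η)
      linarith
    rw [log_sqrt_div hσ ht, Real.sq_sqrt ht.le]
    have h1 : 0 ≤ 1 / σ ^ 2 - 1 / t :=
      sub_nonneg.2 (one_div_le_one_div_of_le hs hσt.le)
    have h2 : energy x / 2 * (1 / σ ^ 2 - 1 / t) ≤ (t + η) / 2 * (1 / σ ^ 2 - 1 / t) :=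
      mul_le_mul_of_nonneg_right (div_le_div_of_nonneg_right hx1.le (by norm_num)) h1
    have h3 : t / 2 * (1 / σ ^ 2 - 1 / t) = 1 / 2 * (t / σ ^ 2 - 1) := by field_simp
    have h4 : η / 2 * (1 / σ ^ 2 - 1 / t) ≤ η / 2 * (1 / σ ^ 2) :=
      mul_le_mul_of_nonneg_left (sub_le_self _ (by positivity)) (by positivity)
    have h5 : η / 2 * (1 / σ ^ 2) = (a - J) / 2 := by rw [hη]; field_simp
    have h6 : (t + η) / 2 * (1 / σ ^ 2 - 1 / t) =
      t / 2 * (1 / σ ^ 2 - 1 / t) + η / 2 * (1 / σ ^ 2 - 1 / t) := by ring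
    linarith
  calc ENNReal.ofReal (Real.exp (n * -a))
      ≤ ENNReal.ofReal (Real.exp (n * -((a + J) / 2))) * (1 / 2) := by
        have : (1 / 2 : ENNReal) = ENNReal.ofReal (1 / 2) := by
          rw [ENNReal.ofReal_div_of_pos (by norm_num)]; simp
        rw [this, ← ENNReal.ofReal_mul (Real.exp_pos _).le]
        refine ENNReal.ofReal_le_ofReal ?_
        rw [show (n : ℝ) * -a = n * -((a + J) / 2) + -((a - J) / 2 * n) by ring, Real.exp_add]
        exact mul_le_mul_of_nonneg_left hd.le (Real.exp_pos _).le
    _ ≤ _ := mul_le_mul_right hhalf _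
    _ ≤ _ := hlow
    _ ≤ _ := measure_mono fun x hx => hS n hn x (hx.1.trans_le (min_le_left _ _))
        (hx.2.trans_le (min_le_left _ _))

/-- The exponent of a sequence of events that lie in `{energy ≥ r}` up to null sets, and that
contain the vectors of small correlation and of energy near `t`, for `t > max r σ²`. -/
theorem tendsto_neg_log_covertextLaw {σ : ℝ} (hσ : 0 < σ) (u : (n : ℕ) → Fin n → ℝ)
    (hu : ∀ n i, u n i = 1 ∨ u n i = -1) {S : (n : ℕ) → Set (Fin n → ℝ)} {r : ℝ}
    (hup : ∀ n > 0, covertextLaw σ n (S n \ {x | r ≤ energy x}) = 0)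
    (hlow : ∀ t, r < t → σ ^ 2 < t →
      ∃ δ > 0, ∀ n > 0, ∀ x, |energy x - t| < δ → |corr x (u n)| < δ → x ∈ S n) :
    Tendsto (fun n : ℕ => -ENNReal.log (covertextLaw σ n (S n)) / (n : EReal)) atTop
      (𝓝 (energyExponent σ r : EReal)) := by
  refine tendsto_neg_log_div_of_exp_bounds ?_ fun a ha => ?_
  · filter_upwards [eventually_gt_atTop 0] with n hn
    refine le_trans ?_ (covertextLaw_energy_ge_le hσ r n)
    exact measure_mono_ae (ae_le_set.2 (hup n hn))
  · obtain ⟨t, hrt, hσt, hta⟩ := exists_energyRate_lt hσ ha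
    obtain ⟨δ, hδ, hS⟩ := hlow t hrt hσt
    exact eventually_exp_le_covertextLaw hσ u hu hσt hδ hS hta

theorem tendsto_neg_log_of_null {P : ℕ → ENNReal} (h : ∀ n > 0, P n = 0) :
    Tendsto (fun n : ℕ => -ENNReal.log (P n) / (n : EReal)) atTop (𝓝 ⊤) := by
  refine tendsto_const_nhds.congr' ?_
  filter_upwards [eventually_gt_atTop 0] with n hn
  rw [h n hn, ENNReal.log_zero, EReal.neg_bot,
    EReal.top_div_of_pos_ne_top (by exact_mod_cast hn) (EReal.natCast_ne_top n)]

/-! ### The detector and the algebra of embedding. -/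

theorem empiricalMutualInfo_le_iff {n : ℕ} (u y : Fin n → ℝ) (lam : ℝ) :
    empiricalMutualInfo u y ≤ (lam : EReal) ↔
      Real.exp (-2 * lam) ≤ 1 - corr y u ^ 2 / energy y := by
  unfold empiricalMutualInfo
  set z := 1 - corr y u ^ 2 / energy y
  rcases le_or_gt z 0 with hz | hz
  · rw [ENNReal.log_ofReal, if_pos hz, EReal.coe_mul_bot_of_pos (by norm_num), EReal.neg_bot]
    simp only [top_le_iff, EReal.coe_ne_top, false_iff, not_le]
    exact hz.trans_lt (Real.exp_pos _)
  · rw [ENNReal.log_ofReal_of_pos hz, ← EReal.coe_mul, ← EReal.coe_neg, EReal.coe_le_coe_iff,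
      ← Real.le_log_iff_exp_le hz]
    constructor <;> intro h <;> linarith

theorem energy_nonneg {n : ℕ} (x : Fin n → ℝ) : 0 ≤ energy x := by
  unfold energy
  positivity

theorem energy_sign {n : ℕ} (hn : 0 < n) {u : Fin n → ℝ} (hu : ∀ i, u i = 1 ∨ u i = -1) :
    energy u = 1 := by
  have hn' : (n : ℝ) ≠ 0 := by positivity
  have : ∀ i, u i ^ 2 = 1 := fun i => by rcases hu i with h | h <;> simp [h]
  simp [energy, this, hn']

theorem energy_smul_add_smul {n : ℕ} (x u : Fin n → ℝ) (a b : ℝ) :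
    energy (a • x + b • u) = a ^ 2 * energy x + 2 * a * b * corr x u + b ^ 2 * energy u := by
  simp only [energy, corr, Finset.mul_sum, ← Finset.sum_add_distrib]
  refine Finset.sum_congr rfl fun i _ => ?_
  simp only [Pi.add_apply, Pi.smul_apply, smul_eq_mul]
  ring

theorem corr_smul_add_smul {n : ℕ} (x u : Fin n → ℝ) (a b : ℝ) :
    corr (a • x + b • u) u = a * corr x u + b * energy u := by
  simp only [energy, corr, Finset.mul_sum, ← Finset.sum_add_distrib]
  refine Finset.sum_congr rfl fun i _ => ?_
  simp only [Pi.add_apply, Pi.smul_apply, smul_eq_mul]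
  ring

theorem corr_sq_le_energy {n : ℕ} (hn : 0 < n) (x : Fin n → ℝ) {u : Fin n → ℝ}
    (hu : ∀ i, u i = 1 ∨ u i = -1) : corr x u ^ 2 ≤ energy x := by
  have h := energy_nonneg ((1 : ℝ) • x + (-corr x u) • u)
  rw [energy_smul_add_smul, energy_sign hn hu] at h
  linarith

theorem sgn_mul_self (t : ℝ) : sgn t * t = |t| := by
  unfold sgn
  split_ifs with h
  · rw [abs_of_nonneg h, one_mul]
  · rw [abs_of_neg (not_le.1 h), neg_one_mul]

theorem sgn_sq (t : ℝ) : sgn t ^ 2 = 1 := by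
  unfold sgn
  split_ifs <;> norm_num

/-! ### Misses of the sign embedder. -/

section SignEmbedder

variable {D : ℝ} {n : ℕ} {u : Fin n → ℝ}

theorem corr_signEmbedder_sq (hn : 0 < n) (hu : ∀ i, u i = 1 ∨ u i = -1) (x : Fin n → ℝ) :
    corr (signEmbedder D n x u) u ^ 2 = (|corr x u| + √D) ^ 2 := by
  have h := corr_smul_add_smul x u 1 (sgn (corr x u) * √D)
  rw [one_smul, energy_sign hn hu] at h
  rw [signEmbedder, h, ← sgn_mul_self]
  linear_combination (-(corr x u ^ 2)) * sgn_sq (corr x u) + (√D) ^ 2 * sgn_sq (corr x u)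

theorem energy_signEmbedder (hn : 0 < n) (hu : ∀ i, u i = 1 ∨ u i = -1) (x : Fin n → ℝ) :
    energy (signEmbedder D n x u) = energy x - corr x u ^ 2 + (|corr x u| + √D) ^ 2 := by
  have h := energy_smul_add_smul x u 1 (sgn (corr x u) * √D)
  rw [one_smul, energy_sign hn hu] at h
  rw [signEmbedder, h, ← sgn_mul_self]
  linear_combination (-(corr x u ^ 2)) * sgn_sq (corr x u) + (√D) ^ 2 * sgn_sq (corr x u)

theorem signEmbedder_miss (hn : 0 < n) (hu : ∀ i, u i = 1 ∨ u i = -1) {x : Fin n → ℝ} {lam : ℝ}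
    (hlam : 0 ≤ lam)
    (h : empiricalMutualInfo u (signEmbedder D n x u) ≤ (lam : EReal)) :
    Real.exp (-2 * lam) * (|corr x u| + √D) ^ 2 ≤
      (1 - Real.exp (-2 * lam)) * (energy x - corr x u ^ 2) := by
  rw [empiricalMutualInfo_le_iff, corr_signEmbedder_sq hn hu, energy_signEmbedder hn hu] at h
  have hcs := corr_sq_le_energy hn x hu
  have hc1 : Real.exp (-2 * lam) ≤ 1 := Real.exp_le_one_iff.2 (by linarith)
  set c := Real.exp (-2 * lam)
  set w := (|corr x u| + √D) ^ 2
  have hw : 0 ≤ w := sq_nonneg _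
  -- The first case is y = 0, where the quotient is read as 0.
  rcases (add_nonneg (sub_nonneg.2 hcs) hw).eq_or_lt with h0 | h0
  · have h1 : w = 0 := by linarith
    rw [h1, mul_zero]
    exact mul_nonneg (by linarith) (by linarith)
  · rw [le_sub_comm, div_le_iff₀ h0] at h
    linarith

theorem signEmbedder_miss_of (hn : 0 < n) (hu : ∀ i, u i = 1 ∨ u i = -1) {x : Fin n → ℝ}
    {lam : ℝ} (hx : corr x u ^ 2 < energy x)
    (h : Real.exp (-2 * lam) * (|corr x u| + √D) ^ 2 ≤
      (1 - Real.exp (-2 * lam)) * (energy x - corr x u ^ 2)) :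
    empiricalMutualInfo u (signEmbedder D n x u) ≤ (lam : EReal) := by
  rw [empiricalMutualInfo_le_iff, corr_signEmbedder_sq hn hu, energy_signEmbedder hn hu,
    le_sub_comm, div_le_iff₀ (add_pos_of_pos_of_nonneg (sub_pos.2 hx) (sq_nonneg _))]
  linarith

theorem le_energy_of_signEmbedder_miss (hD : 0 ≤ D) (hn : 0 < n)
    (hu : ∀ i, u i = 1 ∨ u i = -1) {x : Fin n → ℝ} {lam : ℝ} (hlam : 0 < lam)
    (h : empiricalMutualInfo u (signEmbedder D n x u) ≤ (lam : EReal)) :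
    D * Real.exp (-2 * lam) / (1 - Real.exp (-2 * lam)) ≤ energy x := by
  have h1 := signEmbedder_miss hn hu hlam.le h
  have hc1 : Real.exp (-2 * lam) < 1 := Real.exp_lt_one_iff.2 (by linarith)
  rw [div_le_iff₀ (by linarith)]
  have h2 : D ≤ (|corr x u| + √D) ^ 2 := by
    nth_rewrite 1 [← Real.sq_sqrt hD]
    exact pow_le_pow_left₀ (Real.sqrt_nonneg D) (by linarith [abs_nonneg (corr x u)]) 2
  have h3 := mul_le_mul_of_nonneg_left h2 (Real.exp_pos (-2 * lam)).le
  have h4 := mul_nonneg (sub_nonneg.2 hc1.le) (sq_nonneg (corr x u))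
  linarith

theorem corr_eq_zero_of_signEmbedder_miss_zero (hn : 0 < n) (hu : ∀ i, u i = 1 ∨ u i = -1)
    {x : Fin n → ℝ} (h : empiricalMutualInfo u (signEmbedder D n x u) ≤ ((0 : ℝ) : EReal)) :
    corr x u = 0 := by
  have h1 := signEmbedder_miss hn hu le_rfl h
  simp only [mul_zero, Real.exp_zero, one_mul, sub_self, zero_mul] at h1
  have h2 : |corr x u| + √D = 0 := by simpa using le_antisymm h1 (sq_nonneg _)
  have := Real.sqrt_nonneg D
  exact abs_nonpos_iff.1 (by linarith)

end SignEmbedder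

theorem exists_signEmbedder_miss_nhds {D lam t : ℝ} (hlam : 0 < lam) (hD : 0 ≤ D)
    (ht : D * Real.exp (-2 * lam) / (1 - Real.exp (-2 * lam)) < t) :
    ∃ δ > 0, ∀ n > 0, ∀ u : Fin n → ℝ, (∀ i, u i = 1 ∨ u i = -1) → ∀ x : Fin n → ℝ,
      |energy x - t| < δ → |corr x u| < δ →
        empiricalMutualInfo u (signEmbedder D n x u) ≤ (lam : EReal) := by
  have hc0 : 0 < Real.exp (-2 * lam) := Real.exp_pos _
  have hc1 : 0 < 1 - Real.exp (-2 * lam) := sub_pos.2 (Real.exp_lt_one_iff.2 (by linarith))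
  rw [div_lt_iff₀ hc1] at ht
  set c := Real.exp (-2 * lam) with hc
  -- The slack in the miss inequality at the worst values α² = t - δ and |ρ| = δ; it is positive at
  -- δ = 0.
  have hcont : Continuous fun δ : ℝ => (1 - c) * (t - δ - δ ^ 2) - c * (δ + √D) ^ 2 := by fun_prop
  have h0 : 0 < (1 - c) * (t - 0 - 0 ^ 2) - c * (0 + √D) ^ 2 := by
    rw [zero_add, Real.sq_sqrt hD]
    linarith
  obtain ⟨δ, hδ, hδ0⟩ := (((hcont.tendsto 0).mono_left nhdsWithin_le_nhds).eventually
    (lt_mem_nhds h0) |>.and (self_mem_nhdsWithin (s := Set.Ioi (0 : ℝ)))).exists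
  have hδ0 : 0 < δ := hδ0
  refine ⟨δ, hδ0, fun n hn u hu x hx hxu => ?_⟩
  have h1 : corr x u ^ 2 ≤ δ ^ 2 := sq_le_sq' (abs_lt.1 hxu).1.le (abs_lt.1 hxu).2.le
  have h2 : (|corr x u| + √D) ^ 2 ≤ (δ + √D) ^ 2 :=
    pow_le_pow_left₀ (by positivity) (by linarith) 2
  have h3 := (abs_lt.1 hx).1
  have h4 : 0 < t - δ - δ ^ 2 := by
    have : 0 ≤ c * (δ + √D) ^ 2 := by positivity
    exact pos_of_mul_pos_right (by linarith) hc1.le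
  refine signEmbedder_miss_of hn hu (by linarith) ?_
  calc c * (|corr x u| + √D) ^ 2 ≤ c * (δ + √D) ^ 2 := mul_le_mul_of_nonneg_left h2 hc0.le
    _ ≤ (1 - c) * (t - δ - δ ^ 2) := by linarith
    _ ≤ _ := mul_le_mul_of_nonneg_left (by linarith) hc1.le

/-! ### Misses of the improved sign embedder. -/

theorem improvedSignEmbedder_of_lt {D : ℝ} {n : ℕ} {x : Fin n → ℝ} (u : Fin n → ℝ)
    (h : D < energy x) : improvedSignEmbedder D n x u = signEmbedder D n x u := by
  simp [improvedSignEmbedder, improvedCoeffs, signEmbedder, h.not_ge]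

/-- The output is b u. If b ≠ 0 the quotient is 1 and the information infinite; b = 0 makes the
square root equal to -ρ, and squaring gives α² = D. -/
theorem energy_eq_of_improvedSignEmbedder_miss {D : ℝ} {n : ℕ} (hn : 0 < n) {u : Fin n → ℝ}
    (hu : ∀ i, u i = 1 ∨ u i = -1) {x : Fin n → ℝ} {lam : ℝ} (hx : energy x ≤ D)
    (h : empiricalMutualInfo u (improvedSignEmbedder D n x u) ≤ (lam : EReal)) :
    energy x = D := by
  set b := corr x u + √(corr x u ^ 2 - energy x + D) with hb
  have hy : improvedSignEmbedder D n x u = (0 : ℝ) • x + b • u := by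
    simp [improvedSignEmbedder, improvedCoeffs, hx, hb]
  rw [empiricalMutualInfo_le_iff, hy, corr_smul_add_smul, energy_smul_add_smul,
    energy_sign hn hu] at h
  have hb0 : b = 0 := by
    by_contra hne
    have : (0 * corr x u + b * 1) ^ 2 / (0 ^ 2 * energy x + 2 * 0 * b * corr x u + b ^ 2 * 1) = 1 := by
      field_simp
      ring
    rw [this, sub_self] at h
    exact h.not_gt (Real.exp_pos _)
  have h1 : √(corr x u ^ 2 - energy x + D) = -corr x u := by linarith
  have h2 : 0 ≤ corr x u ^ 2 - energy x + D := by linarith [sq_nonneg (corr x u)]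
  have h3 := Real.sq_sqrt h2
  rw [h1] at h3
  linarith

/-! ### The exponents of both embedders. -/

section Exponents

variable {σ D lam : ℝ} {u : (n : ℕ) → Fin n → ℝ}

theorem exists_improvedSignEmbedder_miss_nhds (hD : 0 ≤ D) (hlam : 0 < lam)
    (hu : ∀ n i, u n i = 1 ∨ u n i = -1) {t : ℝ} (hDt : D < t)
    (ht : D * Real.exp (-2 * lam) / (1 - Real.exp (-2 * lam)) < t) :
    ∃ δ > 0, ∀ n > 0, ∀ x : Fin n → ℝ, |energy x - t| < δ → |corr x (u n)| < δ →
      x ∈ {x | empiricalMutualInfo (u n) (improvedSignEmbedder D n x (u n)) ≤ (lam : EReal)} := by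
  obtain ⟨δ, hδ, h⟩ := exists_signEmbedder_miss_nhds hlam hD ht
  refine ⟨min δ (t - D), lt_min hδ (sub_pos.2 hDt), fun n hn x hx hxu => ?_⟩
  have h1 := (abs_lt.1 (hx.trans_le (min_le_right _ _))).1
  change empiricalMutualInfo _ _ ≤ _
  rw [improvedSignEmbedder_of_lt (u n) (by linarith)]
  exact h n hn (u n) (hu n) x (hx.trans_le (min_le_left _ _)) (hxu.trans_le (min_le_left _ _))

theorem hasFalseNegExponent_improvedSignEmbedder_of_log_two_lt (hσ : 0 < σ) (hD : 0 ≤ D)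
    (hu : ∀ n i, u n i = 1 ∨ u n i = -1) (hlam : 1 / 2 * Real.log 2 < lam) :
    HasFalseNegExponent (improvedSignEmbedder D) σ lam u (energyExponent σ D : ℝ) := by
  have hlam0 : 0 < lam := (mul_pos (by norm_num) (Real.log_pos (by norm_num))).trans hlam
  refine tendsto_neg_log_covertextLaw hσ u hu (fun n hn => ?_) fun t hDt _ =>
    exists_improvedSignEmbedder_miss_nhds hD hlam0 hu hDt (lt_of_le_of_lt ?_ hDt)
  · convert measure_empty (μ := covertextLaw σ n)
    refine Set.eq_empty_of_forall_notMem fun x hx => hx.2 ?_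
    by_contra hlt
    exact hlt (energy_eq_of_improvedSignEmbedder_miss hn (hu n) (not_le.1 hlt).le hx.1).ge
  -- Here c < 1/2, so r₀ ≤ D and the threshold is D.
  · have hc : Real.exp (-2 * lam) < 1 / 2 := by
      rw [← Real.lt_log_iff_exp_lt (by norm_num), one_div, Real.log_inv]
      linarith
    rw [div_le_iff₀ (by linarith)]
    exact mul_le_mul_of_nonneg_left (by linarith) hD

theorem hasFalseNegExponent_improvedSignEmbedder (hσ : 0 < σ) (hD : 0 ≤ D)
    (hu : ∀ n i, u n i = 1 ∨ u n i = -1) (hlam : 0 ≤ lam) (hlam2 : lam ≤ 1 / 2 * Real.log 2) :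
    HasFalseNegExponent (improvedSignEmbedder D) σ lam u (signExponent σ lam D) := by
  have hu0 : ∀ n i, u n i ≠ 0 := fun n i => by rcases hu n i with h | h <;> simp [h]
  unfold signExponent
  split_ifs with h0
  · subst h0
    refine tendsto_neg_log_of_null fun n hn => ?_
    refine measure_mono_null (t := {x | energy x = D} ∪ {x | corr x (u n) = 0}) (fun x hx => ?_)
      (measure_union_null (covertextLaw_energy_eq hσ hn D)
        (covertextLaw_corr_eq_zero hσ hn (u n) (hu0 n)))
    rcases le_or_gt (energy x) D with h | h
    · exact Or.inl (energy_eq_of_improvedSignEmbedder_miss hn (hu n) h hx)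
    · refine Or.inr (corr_eq_zero_of_signEmbedder_miss_zero (D := D) hn (hu n) ?_)
      rw [← improvedSignEmbedder_of_lt (u n) h]
      exact hx
  · have hlam0 : 0 < lam := lt_of_le_of_ne hlam (Ne.symm h0)
    have hc1 : Real.exp (-2 * lam) < 1 := Real.exp_lt_one_iff.2 (by linarith)
    have hc2 : 1 / 2 ≤ Real.exp (-2 * lam) := by
      rw [← Real.log_le_iff_le_exp (by norm_num), one_div, Real.log_inv]
      linarith
    have hDr : D ≤ D * Real.exp (-2 * lam) / (1 - Real.exp (-2 * lam)) := by
      rw [le_div_iff₀ (by linarith)]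
      exact mul_le_mul_of_nonneg_left (by linarith) hD
    refine tendsto_neg_log_covertextLaw hσ u hu (fun n hn => ?_) fun t ht _ =>
      exists_improvedSignEmbedder_miss_nhds hD hlam0 hu (hDr.trans_lt ht) ht
    -- Below r₀ a miss can occur only at α² = D: for α² > D the rule is the sign embedder, whose
    -- misses have α² ≥ r₀.
    refine measure_mono_null (fun x hx => ?_) (covertextLaw_energy_eq hσ hn D)
    rcases le_or_gt (energy x) D with h | h
    · exact energy_eq_of_improvedSignEmbedder_miss hn (hu n) h hx.1
    · refine absurd (le_energy_of_signEmbedder_miss hD hn (hu n) hlam0 ?_) hx.2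
      rw [← improvedSignEmbedder_of_lt (u n) h]
      exact hx.1

theorem hasFalseNegExponent_signEmbedder (hσ : 0 < σ) (hD : 0 ≤ D)
    (hu : ∀ n i, u n i = 1 ∨ u n i = -1) (hlam : 0 ≤ lam) :
    HasFalseNegExponent (signEmbedder D) σ lam u (signExponent σ lam D) := by
  have hu0 : ∀ n i, u n i ≠ 0 := fun n i => by rcases hu n i with h | h <;> simp [h]
  unfold signExponent
  split_ifs with h0
  · subst h0
    exact tendsto_neg_log_of_null fun n hn => measure_mono_null
      (fun x hx => corr_eq_zero_of_signEmbedder_miss_zero hn (hu n) hx)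
      (covertextLaw_corr_eq_zero hσ hn (u n) (hu0 n))
  · have hlam0 : 0 < lam := lt_of_le_of_ne hlam (Ne.symm h0)
    refine tendsto_neg_log_covertextLaw hσ u hu (fun n hn => ?_) fun t ht _ => ?_
    · convert measure_empty (μ := covertextLaw σ n)
      exact Set.eq_empty_of_forall_notMem fun x hx =>
        hx.2 (le_energy_of_signEmbedder_miss hD hn (hu n) hlam0 hx.1)
    · obtain ⟨δ, hδ, h⟩ := exists_signEmbedder_miss_nhds hlam0 hD ht
      exact ⟨δ, hδ, fun n hn x => h n hn (u n) (hu n) x⟩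

end Exponents

end Watermark

theorem corollary1 (σ D lam : ℝ) (hσ : 0 < σ) (hD : 0 ≤ D) (hlam : 0 ≤ lam)
    (u : (n : ℕ) → Fin n → ℝ) (hu : ∀ n i, u n i = 1 ∨ u n i = -1) :
    (1 / 2 * Real.log 2 < lam →
      Watermark.HasFalseNegExponent (Watermark.improvedSignEmbedder D) σ lam u
        (if D ≤ σ ^ 2 then 0
          else ((1 / 2 * (D / σ ^ 2 - Real.log (D / σ ^ 2) - 1) : ℝ) : EReal))) ∧
    (lam ≤ 1 / 2 * Real.log 2 →
      Watermark.HasFalseNegExponent (Watermark.improvedSignEmbedder D) σ lam u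
        (Watermark.signExponent σ lam D) ∧
      Watermark.HasFalseNegExponent (Watermark.signEmbedder D) σ lam u
        (Watermark.signExponent σ lam D)) := by
  refine ⟨fun h => ?_, fun h => ⟨?_, ?_⟩⟩
  · have := Watermark.hasFalseNegExponent_improvedSignEmbedder_of_log_two_lt hσ hD hu h
    unfold Watermark.energyExponent at this
    split_ifs at this ⊢ with hle
    · exact this
    · exact this
  · exact Watermark.hasFalseNegExponent_improvedSignEmbedder hσ hD hu hlam h
  · exact Watermark.hasFalseNegExponent_signEmbedder hσ hD hu hlam
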